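/- **Proposition (Reservoir Lemma).** For an integer $r\ge 1$, an *$r$-path* in a graph $H$ is a sequence of distinct vertices $v_1,\dots,v_m$ such that $v_iv_j\in E(H)$ whenever $0<|i-j|\le r$ (i.e. the $r$-th power of a path). It *connects* the ordered $r$-cliques $K$ and $K'$ if $K=(v_1,\dots,v_r)$ and $K'=(v_{m-r+1},\dots,v_m)$ are disjoint; the other vertices are its *internal* vertices. An ordered $r$-clique of a graph is a sequence of $r$ distinct, pairwise adjacent vertices. Let $G(n,p)$ denote the binomial random graph on $\{1,\dots,n\}$ with edge probability $p$. For every integer $k\ge 0$, every $\varepsilon>0$ and every $\gamma\in(0,1)$ there exists $C>1$ such that the following holds. For every sequence $(G_n)_{n\in\mathbb N}$ of graphs, $G_n$ having vertex set $\{1,\dots,n\}$, with $\delta(G_n)\ge\left(\frac{k}{k+1}+\varepsilon\right)n$ for all sufficiently large $n$, there are sets $R_n\subseteq\{1,\dots,n\}$ of size $|R_n|=\lfloor\gamma^2n\rfloor$ such that for every $p\colon\mathbb N\to[0,1]$ with $p(n)\ge C/n$ for all sufficiently large $n$, the probability that $H_n=G_n\cup G(n,p(n))$ has the following property tends to $1$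 as $n\to\infty$: For every $S\subseteq R_n$ with $|S|\le\varepsilon|R_n|/4$ and every pair of disjoint ordered $(k+1)$-cliques $K,K'$ in $G_n-R_n$, there exists a $(k+1)$-path in $H_n$ that connects $K$ and $K'$ and has exactly $(k+1)2^{k+1}$ internal vertices, all of which belong to $R_n\setminus S$. -/

import Mathlib

open Filter Topology

/-- An ordered `m`-clique `K 0, …, K (m - 1)` of the graph `G`
(pairwise adjacency makes the vertices distinct). -/
def IsOrderedClique {V : Type*} (G : SimpleGraph V) {m : ℕ} (K : Fin m → V) : Prop :=
  ∀ i j : Fin m, i ≠ j → G.Adj (K i) (K j)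

/-- The vertex sequence `P 0, …, P (m - 1)` is an `r`-path in `H`, that is, the `r`-th power of a
path: its vertices are distinct, and any two of them at distance at most `r` along the path are
adjacent in `H`. -/
def IsPowerPath {V : Type*} (H : SimpleGraph V) (r : ℕ) {m : ℕ} (P : Fin m → V) : Prop :=
  Function.Injective P ∧
    ∀ i j : Fin m, i < j → (j : ℕ) ≤ (i : ℕ) + r → H.Adj (P i) (P j)

/-- Some `r`-path of `H`, whose first `r` vertices are `K` and whose last `r` vertices are `K'`
(in this order), has exactly `l` internal vertices, all of which lie in `W`. -/
def IsConnectedThrough {V : Type*} (H : SimpleGraph V) (r l : ℕ) (W : Finset V)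
    (K K' : Fin r → V) : Prop :=
  ∃ Q : Fin l → V, (∀ i, Q i ∈ W) ∧ IsPowerPath H r (Fin.append (Fin.append K Q) K')

/-- The reservoir property of `R`, with base graph `G` and augmented graph `H`: after deleting any
`S ⊆ R` with `|S| ≤ ε |R| / 4`, any two disjoint ordered `(k+1)`-cliques of `G - R` are connected
by a `(k+1)`-path of `H` with exactly `(k+1) 2 ^ (k+1)` internal vertices, all in `R \ S`. -/
def IsReservoir {V : Type*} [DecidableEq V] (k : ℕ) (ε : ℝ) (G H : SimpleGraph V)
    (R : Finset V) : Prop :=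
  ∀ S : Finset V, S ⊆ R → (S.card : ℝ) ≤ ε * (R.card : ℝ) / 4 →
    ∀ K K' : Fin (k + 1) → V, IsOrderedClique G K → IsOrderedClique G K' →
      (∀ i, K i ∉ R) → (∀ i, K' i ∉ R) → (∀ i j, K i ≠ K' j) →
        IsConnectedThrough H (k + 1) ((k + 1) * 2 ^ (k + 1)) (R \ S) K K'

/-!
Put `r = k + 1`. The minimum degree gives every `r` vertices linearly many common neighbours, and
this survives passing to a random set `R` of density `γ ^ 2` and deleting a small `S ⊆ R`.
Consequently a positive proportion of the choices of finitely many vertices of `R \ S` form a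
staircase of cliques leading from `K` to a common middle clique and from there to `K'`. Blowing up
each chosen vertex into several independent copies, which costs only a power in the density by
Jensen's inequality, makes the resulting walk visit distinct vertices. Thus a positive proportion
of all vertex sequences of length `r * 2 ^ r` are injective and satisfy, in `G` alone, every
adjacency required of an `r`-path from `K` to `K'`, except those at distance exactly `r`.

The random graph has to supply the edges at distance exactly `r`. It is exposed in rounds, each of
which supplies one of these edges for a positive proportion of the surviving sequences. A round
fails with probability at most `n ^ O(1) * exp (-2 * n)` when `C` is large, which beats the
`2 ^ n * n ^ (2 * r)` choices of `S`, `K` and `K'`.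
-/

open scoped BigOperators

open Classical in
/-- The proportion of the elements of a finite type that satisfy `P`; it is `0` on an empty type. -/
noncomputable def density {α : Type*} [Fintype α] (P : α → Prop) : ℝ :=
  𝔼 a, if P a then 1 else 0

section Density

variable {α β : Type*} [Fintype α] [Fintype β]

theorem density_mul_card (P : α → Prop) [DecidablePred P] :
    density P * Fintype.card α = Finset.card {a | P a} := by
  have h : ∑ a, (if P a then (1 : ℝ) else 0) = Finset.card {a | P a} := Finset.sum_boole ..
  rw [← h, mul_comm, ← Fintype.card_smul_expect, nsmul_eq_mul, density]
  congr!

theorem density_nonneg (P : α → Prop) : 0 ≤ density P :=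
  Finset.expect_nonneg fun a _ => by split_ifs <;> norm_num

theorem density_mono {P Q : α → Prop} (h : ∀ a, P a → Q a) : density P ≤ density Q := by
  refine Finset.expect_le_expect fun a _ => ?_
  by_cases hP : P a
  · simp [hP, h a hP]
  · rw [if_neg hP]
    split_ifs <;> norm_num

theorem density_le_one (P : α → Prop) : density P ≤ 1 := by
  rcases isEmpty_or_nonempty α with hα | hα
  · simp [density]
  · exact Finset.expect_le Finset.univ_nonempty fun a _ => by split_ifs <;> norm_num

theorem density_eq_one [Nonempty α] {P : α → Prop} (h : ∀ a, P a) : density P = 1 := by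
  simp [density, h]

theorem exists_of_density_pos {P : α → Prop} (h : 0 < density P) : ∃ a, P a := by
  by_contra! hP
  simp [density, hP] at h

theorem density_equiv (e : α ≃ β) (P : β → Prop) : density (fun a => P (e a)) = density P :=
  Fintype.expect_equiv e _ _ fun _ => rfl

theorem density_prod (P : α × β → Prop) : density P = 𝔼 a, density fun b => P (a, b) := by
  rw [density, ← Finset.univ_product_univ, Finset.expect_product]
  rfl

theorem density_prod_fst [Nonempty β] (P : α → Prop) :
    density (fun x : α × β => P x.1) = density P := by
  rw [density_prod, density]
  refine Finset.expect_congr rfl fun a _ => ?_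
  by_cases h : P a <;> simp [density, h]

theorem density_le_density_add_density {P Q R : α → Prop} (h : ∀ a, P a → Q a ∨ R a) :
    density P ≤ density Q + density R := by
  simp only [density, ← Finset.expect_add_distrib]
  refine Finset.expect_le_expect fun a _ => ?_
  by_cases hP : P a
  · rcases h a hP with hQ | hR
    · simpa [hP, hQ] using by split_ifs <;> norm_num
    · simpa [hP, hR] using by split_ifs <;> norm_num
  · simpa [hP] using by split_ifs <;> norm_num

theorem density_add_density_sub_one_le_density_and (P Q : α → Prop) :
    density P + density Q - 1 ≤ density fun a => P a ∧ Q a := by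
  rcases isEmpty_or_nonempty α with hα | hα
  · simp [density]
  · rw [sub_le_iff_le_add, ← density_eq_one (α := α) (P := fun _ => True) fun _ => trivial]
    simp only [density, ← Finset.expect_add_distrib]
    refine Finset.expect_le_expect fun a _ => ?_
    by_cases hP : P a <;> by_cases hQ : Q a <;> simp [hP, hQ]

theorem mul_le_density_prod {c d : ℝ} (hd : 0 ≤ d) {P : α → Prop} {Q : α × β → Prop}
    (hP : c ≤ density P) (hQ : ∀ a, P a → d ≤ density fun b => Q (a, b)) :
    c * d ≤ density Q := by
  classical
  calc c * d ≤ density P * d := by gcongr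
    _ = 𝔼 a, (if P a then 1 else 0) * d := by rw [density, Finset.expect_mul]
    _ ≤ 𝔼 a, density fun b => Q (a, b) := by
        refine Finset.expect_le_expect fun a _ => ?_
        split_ifs with h
        · simpa using hQ a h
        · simpa using density_nonneg _
    _ = density Q := (density_prod Q).symm

theorem half_le_density_half_le_density {c : ℝ} {Q : α × β → Prop} (hQ : c ≤ density Q) :
    c / 2 ≤ density fun a => c / 2 ≤ density fun b => Q (a, b) := by
  rcases le_or_gt c 0 with hc | hc
  · exact (by linarith : c / 2 ≤ 0).trans (density_nonneg _)
  have : Nonempty α := ⟨(exists_of_density_pos (hc.trans_le hQ)).choose.1⟩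
  refine le_of_add_le_add_right (a := c / 2) ?_
  calc c / 2 + c / 2 = c := add_halves c
    _ ≤ 𝔼 a, density fun b => Q (a, b) := hQ.trans_eq (density_prod Q)
    _ ≤ 𝔼 a, ((if c / 2 ≤ density fun b => Q (a, b) then 1 else 0) + c / 2) := by
        refine Finset.expect_le_expect fun a _ => ?_
        split_ifs with h
        · linarith [density_le_one fun b => Q (a, b)]
        · linarith
    _ = _ := by rw [Finset.expect_add_distrib, Fintype.expect_const, density]

theorem density_comp_injective {ι κ V : Type*} [Fintype ι] [Fintype κ]
    [DecidableEq ι] [DecidableEq κ] [Fintype V] [Nonempty V]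
    {g : κ → ι} (hg : g.Injective) (P : (κ → V) → Prop) :
    density (fun z : ι → V => P (z ∘ g)) = density P := by
  let e : (ι → V) ≃ (κ → V) × ({i // i ∉ Set.range g} → V) :=
    (Equiv.piEquivPiSubtypeProd (· ∈ Set.range g) fun _ => V).trans
      (((Equiv.ofInjective g hg).symm.arrowCongr (Equiv.refl V)).prodCongr (Equiv.refl _))
  calc density (fun z : ι → V => P (z ∘ g)) = density fun z => P (e z).1 := rfl
    _ = density fun x : (κ → V) × ({i // i ∉ Set.range g} → V) => P x.1 :=
        density_equiv e fun x => P x.1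
    _ = density P := density_prod_fst P

theorem density_forall_fin (P : α → Prop) (n : ℕ) :
    density (fun x : Fin n → α => ∀ i, P (x i)) = density P ^ n := by
  classical
  simp only [density, Finset.expect_pow, Finset.prod_boole, Fintype.piFinset_univ]
  exact Finset.expect_congr rfl fun x _ => by simp

theorem expect_pow_le_expect_pow [Nonempty α] {f : α → ℝ} (hf : ∀ a, 0 ≤ f a) (n : ℕ) :
    (𝔼 a, f a) ^ n ≤ 𝔼 a, f a ^ n := by
  simp only [Fintype.expect_eq_sum_div_card, div_eq_inv_mul, Finset.mul_sum]
  exact Real.pow_arith_mean_le_arith_mean_pow Finset.univ _ f (fun _ _ => by positivity) (by simp)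
    (fun a _ => hf a) n

theorem pow_le_density_greedy {c : ℝ} (hc : 0 ≤ c) (P : ∀ m, (Fin m → α) → α → Prop) {M : ℕ}
    (hP : ∀ m < M, ∀ u, c ≤ density (P m u)) :
    c ^ M ≤ density fun h : Fin M → α => ∀ m : Fin M, P m (fun i => h (i.castLE m.2.le)) (h m) := by
  induction M with
  | zero => simp [density_eq_one]
  | succ M ih =>
    rw [pow_succ, ← density_equiv ((Equiv.prodComm _ _).trans (Fin.snocEquiv fun _ => α))]
    refine (mul_le_density_prod hc (ih fun m hm => hP m (hm.trans_le M.le_succ))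
      fun h hh => (hP M M.lt_succ_self h).trans (density_mono fun a ha => ?_))
    refine Fin.lastCases ?_ fun m => ?_
    · change P M (fun i => Fin.snoc (α := fun _ => α) h a i.castSucc)
        (Fin.snoc (α := fun _ => α) h a (Fin.last M))
      simpa only [Fin.snoc_castSucc, Fin.snoc_last] using ha
    · change P m (fun i => Fin.snoc (α := fun _ => α) h a (i.castLE m.2.le).castSucc)
        (Fin.snoc (α := fun _ => α) h a m.castSucc)
      simpa only [Fin.snoc_castSucc] using hh m

end Density

section Blowup

theorem density_pow_le_density_forall_fst {α β : Type*} [Fintype α] [Fintype β]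
    [Nonempty β] (Q : α × β → Prop) (n : ℕ) :
    density Q ^ n ≤ density fun p : (Fin n → α) × β => ∀ c, Q (p.1 c, p.2) := by
  calc density Q ^ n = (𝔼 b, density fun a => Q (a, b)) ^ n := by
        rw [← density_equiv (Equiv.prodComm β α), density_prod]; rfl
    _ ≤ 𝔼 b, (density fun a => Q (a, b)) ^ n :=
        expect_pow_le_expect_pow (fun _ => density_nonneg _) n
    _ = 𝔼 b, density fun x : Fin n → α => ∀ c, Q (x c, b) :=
        Finset.expect_congr rfl fun b _ => (density_forall_fin (fun a => Q (a, b)) n).symm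
    _ = _ := by rw [← density_equiv (Equiv.prodComm β (Fin n → α)), density_prod]; rfl

variable {V : Type*} [Fintype V] [Nonempty V]

theorem density_pow_le_density_forall_choice_fin {s : ℕ} (T : (Fin s → V) → Prop) (n : ℕ) :
    density T ^ n ^ s ≤
      density fun z : Fin s → Fin n → V => ∀ c : Fin s → Fin n, T fun i => z i (c i) := by
  induction s with
  | zero =>
    rw [pow_zero, pow_one, ← density_equiv (Equiv.ofUnique (Fin 0 → Fin n → V) (Fin 0 → V))]
    exact density_mono fun z hz c => by convert! hz
  | succ s ih =>
    let Q : V × (Fin s → V) → Prop := fun p => T (Fin.cons p.1 p.2)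
    calc density T ^ n ^ (s + 1) = (density Q ^ n) ^ n ^ s := by
          rw [← pow_mul, pow_succ', ← density_equiv (Fin.consEquiv fun _ => V)]; rfl
      _ ≤ (𝔼 x : Fin n → V, density fun y => ∀ c, Q (x c, y)) ^ n ^ s := by
          rw [← density_prod fun p : (Fin n → V) × (Fin s → V) => ∀ c, Q (p.1 c, p.2)]
          gcongr
          · exact pow_nonneg (density_nonneg Q) n
          · exact density_pow_le_density_forall_fst Q n
      _ ≤ 𝔼 x : Fin n → V, (density fun y => ∀ c, Q (x c, y)) ^ n ^ s :=
          expect_pow_le_expect_pow (fun _ => density_nonneg _) _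
      _ ≤ 𝔼 x : Fin n → V, density fun z : Fin s → Fin n → V =>
            ∀ c' : Fin s → Fin n, ∀ c, Q (x c, fun i => z i (c' i)) :=
          Finset.expect_le_expect fun x _ => ih fun y => ∀ c, Q (x c, y)
      _ ≤ _ := by
          rw [← density_prod fun p : (Fin n → V) × (Fin s → Fin n → V) =>
            ∀ c' : Fin s → Fin n, ∀ c, Q (p.1 c, fun i => p.2 i (c' i)),
            ← density_equiv (Fin.consEquiv fun _ => Fin n → V)]
          refine density_mono fun p hp c => ?_
          convert! hp (fun i => c i.succ) (c 0) using 1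
          exact (Fin.cons_self_tail _).symm

theorem density_pow_le_density_forall_choice {ι : Type*} [Fintype ι] [DecidableEq ι]
    (T : (ι → V) → Prop) (n : ℕ) :
    density T ^ n ^ Fintype.card ι ≤
      density fun z : ι → Fin n → V => ∀ c : ι → Fin n, T fun i => z i (c i) := by
  let e := Fintype.equivFin ι
  rw [← density_equiv (e.symm.arrowCongr (Equiv.refl V)) T,
    ← density_equiv (e.symm.arrowCongr (Equiv.refl (Fin n → V)))]
  refine (density_pow_le_density_forall_choice_fin _ n).trans (density_mono fun z hz c => ?_)
  convert! hz (c ∘ e.symm) using 1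
  ext i
  simp

/-- `x` lies in the blow-up of the family `T` along the labelling `φ` of its indices: every subset
`J` of the indices on which the labels are distinct extends to a member of `T`. -/
def IsBlowup {ι κ V : Type*} (T : (ι → V) → Prop) (φ : κ → ι) (x : κ → V) : Prop :=
  ∀ J : Set κ, J.InjOn φ → ∃ h, T h ∧ J.EqOn (h ∘ φ) x

theorem density_pow_le_density_isBlowup {ι : Type*} [Fintype ι] [DecidableEq ι]
    (T : (ι → V) → Prop) {n : ℕ} (hn : n ≠ 0) (φ : Fin n → ι) :
    density T ^ n ^ Fintype.card ι ≤ density (IsBlowup T φ) := by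
  have := NeZero.mk hn
  have hinj : (fun m => (φ m, m)).Injective := fun m m' h => congrArg Prod.snd h
  rw [← density_comp_injective hinj, ← density_equiv (Equiv.curry ι (Fin n) V).symm]
  refine (density_pow_le_density_forall_choice T n).trans (density_mono fun z hz J hJ => ?_)
  refine ⟨_, hz (Function.invFunOn φ J), fun m hm => ?_⟩
  simp [hJ.leftInvOn_invFunOn hm]

end Blowup

section Walks

theorem one_sub_sq_div_le_density_injective (V : Type*) [Fintype V] [Nonempty V] (M : ℕ) :
    1 - (M : ℝ) ^ 2 / Fintype.card V ≤ density fun x : Fin M → V => x.Injective := by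
  classical
  have hn : (0 : ℝ) < Fintype.card V := by exact_mod_cast Fintype.card_pos
  rcases lt_or_ge (Fintype.card V : ℝ) M with hM | hM
  · refine (sub_nonpos.2 ((one_le_div hn).2 ?_)).trans (density_nonneg _)
    have : (1 : ℝ) ≤ M := by exact_mod_cast Nat.one_le_of_lt (Nat.cast_lt.1 hM)
    nlinarith
  have avoid : ∀ m < M, ∀ u : Fin m → V,
      1 - (M : ℝ) / Fintype.card V ≤ density fun v => ∀ i, u i ≠ v := by
    intro m hm u
    rw [← mul_le_mul_iff_left₀ hn, density_mul_card, one_sub_mul, div_mul_cancel₀ _ hn.ne']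
    have h : Fintype.card V ≤ Finset.card {v | ∀ i, u i ≠ v} + m := by
      have hle : (Finset.univ.image u).card ≤ m := Finset.card_image_le.trans (by simp)
      rw [← Finset.card_add_card_compl (Finset.univ.image u), add_comm]
      refine add_le_add (Finset.card_le_card fun v => ?_) hle
      simp
    have : (Fintype.card V : ℝ) ≤ Finset.card {v | ∀ i, u i ≠ v} + m := by exact_mod_cast h
    have : (m : ℝ) ≤ M := by exact_mod_cast hm.le
    linarith
  calc 1 - (M : ℝ) ^ 2 / Fintype.card V = 1 + M * (-(M / Fintype.card V)) := by ring
    _ ≤ (1 - M / Fintype.card V) ^ M := by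
        rw [sub_eq_add_neg]
        exact one_add_mul_le_pow (by linarith [(div_le_one hn).2 hM]) M
    _ ≤ _ := pow_le_density_greedy (sub_nonneg.2 ((div_le_one hn).2 hM))
        (fun m (u : Fin m → V) v => ∀ i, u i ≠ v) avoid
    _ ≤ _ := density_mono fun x hx => .of_lt_imp_ne fun i j hij => hx j ⟨i, hij⟩

variable {V : Type*} {G H : SimpleGraph V} {W : Finset V} {r : ℕ}

theorem IsOrderedClique.injective {K : Fin r → V} (hK : IsOrderedClique G K) : K.Injective :=
  fun i j hij => by_contra fun hne => (hK i j hne).ne hij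

theorem IsOrderedClique.isPowerPath {K : Fin r → V} (hK : IsOrderedClique G K) (s : ℕ) :
    IsPowerPath G s K :=
  ⟨hK.injective, fun i j hij _ => hK i j hij.ne⟩

theorem IsOrderedClique.mono (h : G ≤ H) {K : Fin r → V} (hK : IsOrderedClique G K) :
    IsOrderedClique H K :=
  fun i j hij => h (hK i j hij)

theorem IsOrderedClique.comp_rev {K : Fin r → V} (hK : IsOrderedClique G K) :
    IsOrderedClique G (K ∘ Fin.rev) :=
  fun i j hij => hK i.rev j.rev (Fin.rev_injective.ne hij)

theorem IsPowerPath.append {m n : ℕ} {P : Fin m → V} {Q : Fin n → V} (hP : IsPowerPath G r P)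
    (hQ : IsPowerPath G r Q) (hdisj : ∀ i j, P i ≠ Q j)
    (hadj : ∀ (i : Fin m) (j : Fin n), m + j ≤ i + r → G.Adj (P i) (Q j)) :
    IsPowerPath G r (Fin.append P Q) := by
  refine ⟨Fin.append_injective_iff.2 ⟨hP.1, hQ.1, hdisj⟩, fun i j hij hd => ?_⟩
  induction i using Fin.addCases with
  | left i =>
    induction j using Fin.addCases with
    | left j => simpa using hP.2 i j hij hd
    | right j => simpa using hadj i j hd
  | right i =>
    induction j using Fin.addCases with
    | left j =>
      exact absurd hij <| Fin.lt_def.not.2 <| by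
        simp only [Fin.val_castAdd, Fin.val_natAdd]
        omega
    | right j => simpa using hQ.2 i j (by simpa using hij) (by simpa [add_assoc] using hd)

/-- The sequence `x` in `W` continues the clique `a` and is continued by the clique `b` in the way
an `r`-path of `G` does, except that entries at distance exactly `r` need not be adjacent and that
vertices may repeat. -/
structure IsSparseWalk (G : SimpleGraph V) (W : Finset V) {L : ℕ} (a b : Fin r → V)
    (x : Fin L → V) : Prop where
  mem : ∀ m, x m ∈ W
  adj : ∀ m m' : Fin L, m < m' → (m' : ℕ) < m + r → G.Adj (x m) (x m')
  left_adj : ∀ (m : Fin L) (j : Fin r), (m : ℕ) ≤ j → G.Adj (a j) (x m)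
  adj_right : ∀ (m : Fin L) (j : Fin r), L + j ≤ (m : ℕ) + r → G.Adj (x m) (b j)

variable {a b : Fin r → V}

theorem IsSparseWalk.isConnectedThrough {Γ : SimpleGraph V} {L : ℕ} {x : Fin L → V}
    (hx : IsSparseWalk G W a b x) (hinj : x.Injective)
    (hΓ : ∀ m m' : Fin L, (m' : ℕ) = m + r → Γ.Adj (x m) (x m'))
    (ha : IsOrderedClique G a) (hb : IsOrderedClique G b) (haW : ∀ i, a i ∉ W)
    (hbW : ∀ i, b i ∉ W) (hab : ∀ i j, a i ≠ b j) (hL : r ≤ L) :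
    IsConnectedThrough (G ⊔ Γ) r L W a b := by
  have path : IsPowerPath (G ⊔ Γ) r x := by
    refine ⟨hinj, fun m m' hlt hd => ?_⟩
    rcases hd.lt_or_eq with h | h
    · exact Or.inl (hx.adj m m' hlt h)
    · exact Or.inr (hΓ m m' h)
  refine ⟨x, hx.mem, IsPowerPath.append (.append ((ha.mono le_sup_left).isPowerPath r) path ?_ ?_)
    ((hb.mono le_sup_left).isPowerPath r) ?_ ?_⟩
  · exact fun i m (h : a i = x m) => haW i (h ▸ hx.mem m)
  · exact fun i m hd => Or.inl (hx.left_adj m i (by omega))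
  · refine fun i j => Fin.addCases (fun i => ?_) (fun m => ?_) i
    · simpa using hab i j
    · simpa using fun h : x m = b j => hbW j (h ▸ hx.mem m)
  · refine fun i j => Fin.addCases (fun i hd => ?_) (fun m hd => ?_) i
    · simp only [Fin.val_castAdd] at hd
      omega
    · rw [Fin.append_right]
      exact Or.inl (hx.adj_right m j (by simp only [Fin.val_natAdd] at hd; omega))

theorem IsBlowup.isSparseWalk {ι : Type*} {L : ℕ} {T : (ι → V) → Prop} {φ : Fin L → ι}
    (hT : ∀ h, T h → IsSparseWalk G W a b (h ∘ φ)) {x : Fin L → V} (hx : IsBlowup T φ x) :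
    IsSparseWalk G W a b x := by
  have single : ∀ m, ∃ h, T h ∧ h (φ m) = x m := fun m => by
    obtain ⟨h, hh, e⟩ := hx {m} (Set.injOn_singleton φ m)
    exact ⟨h, hh, e rfl⟩
  refine ⟨fun m => ?_, fun m m' hlt hd => ?_, fun m j hmj => ?_, fun m j hmj => ?_⟩
  · obtain ⟨h, hh, e⟩ := single m
    exact e ▸ (hT h hh).mem m
  · rcases eq_or_ne (φ m) (φ m') with hφ | hφ
    · obtain ⟨h, hh, -⟩ := single m
      exact absurd (congrArg h hφ) ((hT h hh).adj m m' hlt hd).ne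
    · obtain ⟨h, hh, e⟩ := hx {m, m'} (Set.injOn_pair.2 fun h => absurd h hφ)
      rw [← e (Set.mem_insert m {m'}), ← e (Set.mem_insert_of_mem m rfl)]
      exact (hT h hh).adj m m' hlt hd
  · obtain ⟨h, hh, e⟩ := single m
    exact e ▸ (hT h hh).left_adj m j hmj
  · obtain ⟨h, hh, e⟩ := single m
    exact e ▸ (hT h hh).adj_right m j hmj

/-- Any `r` vertices have at least a proportion `c` of all vertices as common neighbours in `W`. -/
def HasDenseCommonNeighbors [Fintype V] (G : SimpleGraph V) (W : Finset V) (r : ℕ) (c : ℝ) : Prop :=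
  ∀ w : Fin r → V, c ≤ density fun v => v ∈ W ∧ ∀ j, G.Adj (w j) v

/-- `g` is an ordered `r`-clique in `W` whose entry `i` is adjacent to the entries `j ≥ i` of
`base`. -/
structure IsNextBlock (G : SimpleGraph V) (W : Finset V) (base g : Fin r → V) : Prop where
  mem : ∀ i, g i ∈ W
  adj : ∀ {i j}, i < j → G.Adj (g i) (g j)
  base_adj : ∀ {i j}, i ≤ j → G.Adj (base j) (g i)

/-- A sequence of `r` ordered cliques in `W` leading from `κ` to `y`: row `s` need only be used in
its first `r - s` entries, the rest of the block being taken from `y`. -/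
structure IsStaircase (G : SimpleGraph V) (W : Finset V) (κ y : Fin r → V)
    (x : Fin r → Fin r → V) : Prop where
  mem : ∀ s i, x s i ∈ W
  adj : ∀ {s i j}, i < j → G.Adj (x s i) (x s j)
  start_adj : ∀ {s i j : Fin r}, (s : ℕ) = 0 → i ≤ j → G.Adj (κ j) (x s i)
  adj_succ : ∀ {s s' i j : Fin r}, (s' : ℕ) = s + 1 → j < i → (i : ℕ) + s < r →
    G.Adj (x s i) (x s' j)
  adj_target : ∀ {s i j : Fin r}, 0 < (s : ℕ) → i ≤ j → r ≤ (j : ℕ) + s → G.Adj (y j) (x s i)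

theorem IsNextBlock.isOrderedClique {base g : Fin r → V} (hg : IsNextBlock G W base g) :
    IsOrderedClique G g :=
  fun _ _ hij => hij.lt_or_gt.elim hg.adj fun h => (hg.adj h).symm

theorem HasDenseCommonNeighbors.pow_le_density_isNextBlock [Fintype V] {c : ℝ} (hc : 0 ≤ c)
    (hG : HasDenseCommonNeighbors G W r c) (base : Fin r → V) :
    c ^ r ≤ density (IsNextBlock G W base) := by
  let P (m : ℕ) (u : Fin m → V) (v : V) : Prop :=
    v ∈ W ∧ ∀ j : Fin r, G.Adj (if h : (j : ℕ) < m then u ⟨j, h⟩ else base j) v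
  refine (pow_le_density_greedy hc P fun m _ u => hG _).trans (density_mono fun g hg => ?_)
  refine ⟨fun i => (hg i).1, fun {i j} hij => ?_, fun {i j} hij => ?_⟩
  · simpa [Fin.lt_def.1 hij] using (hg j).2 i
  · simpa [(Fin.le_def.1 hij).not_gt] using (hg i).2 j

/-- The clique to which row `s` of a staircase is attached: the start `κ` for the first row, and
otherwise the used entries of the previous row, shifted by one, followed by entries of `y`. -/
def staircaseBase (κ y : Fin r → V) : ∀ {s : ℕ}, (Fin s → Fin r → V) → Fin r → V
  | 0, _ => κ
  | s + 1, x => fun j => if h : (j : ℕ) + (s + 1) < r then x (Fin.last s) ⟨j + 1, by omega⟩ else y j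

theorem isStaircase_of_forall_isNextBlock {κ y : Fin r → V} {x : Fin r → Fin r → V}
    (hx : ∀ s : Fin r, IsNextBlock G W
      (staircaseBase κ y fun i : Fin s => x (i.castLE s.2.le)) (x s)) :
    IsStaircase G W κ y x where
  mem s := (hx s).mem
  adj := (hx _).adj
  start_adj {s i j} hs hij := by
    obtain ⟨s, hs'⟩ := s
    obtain rfl : s = 0 := hs
    exact (hx ⟨0, hs'⟩).base_adj hij
  adj_succ {s s' i j} hs hji hi := by
    obtain ⟨s', hs'⟩ := s'
    obtain rfl : s' = s + 1 := hs
    have := (hx ⟨s + 1, hs'⟩).base_adj (i := j) (j := ⟨i - 1, by omega⟩) (by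
      rw [Fin.le_def]
      dsimp only
      omega)
    simp only [staircaseBase, show (i : ℕ) - 1 + (s + 1) < r by omega,
      show (i : ℕ) - 1 + 1 = i by omega, dif_pos] at this
    exact this
  adj_target {s i j} hs hij hj := by
    obtain ⟨s, hs'⟩ := s
    obtain ⟨s, rfl⟩ : ∃ t, s = t + 1 := ⟨s - 1, (Nat.sub_add_cancel hs).symm⟩
    have := (hx ⟨s + 1, hs'⟩).base_adj hij
    simpa [staircaseBase, show ¬ (j : ℕ) + (s + 1) < r from hj.not_gt] using this

theorem HasDenseCommonNeighbors.pow_le_density_isStaircase [Fintype V] {c : ℝ} (hc : 0 ≤ c)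
    (hG : HasDenseCommonNeighbors G W r c) (κ y : Fin r → V) :
    (c ^ r) ^ r ≤ density (IsStaircase G W κ y) :=
  (pow_le_density_greedy (pow_nonneg hc r)
    (fun s (x : Fin s → Fin r → V) => IsNextBlock G W (staircaseBase κ y x))
    fun _ _ _ => hG.pow_le_density_isNextBlock hc _).trans
      (density_mono fun _ => isStaircase_of_forall_isNextBlock)

/-- The block `t` of the passage from a clique to `y` along the staircase `x`, ending in `y`. -/
def staircaseBlock (y : Fin r → V) (x : Fin r → Fin r → V) (t : ℕ) (i : Fin r) : V :=
  if h : (i : ℕ) + t < r then x ⟨t, by omega⟩ i else y i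

/-- The block `t` of the walk with `N` blocks that follows the staircase `x` from the left end to
the clique `y` and the staircase `z` backwards from `y` to the right end. -/
def gluedBlock (y : Fin r → V) (x z : Fin r → Fin r → V) (N t : ℕ) (i : Fin r) : V :=
  if t < r then staircaseBlock y x t i else staircaseBlock (y ∘ Fin.rev) z (N - 1 - t) i.rev

/-- The concatenation of the `N` blocks of the glued walk. -/
def gluedWalk {N : ℕ} (y : Fin r → V) (x z : Fin r → Fin r → V) (m : Fin (r * N)) : V :=
  gluedBlock y x z N (m / r) (m.cast (mul_comm r N)).modNat

theorem comp_gluedWalk {ι : Type*} (h : ι → V) {N : ℕ} (y : Fin r → ι) (x z : Fin r → Fin r → ι) :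
    h ∘ gluedWalk (N := N) y x z =
      gluedWalk (h ∘ y) (fun s i => h (x s i)) (fun s i => h (z s i)) := by
  ext m
  simp only [Function.comp_apply, gluedWalk, gluedBlock, staircaseBlock]
  split_ifs <;> rfl

section Block

variable {κ y : Fin r → V} {x : Fin r → Fin r → V}

theorem staircaseBlock_eq_target {t : ℕ} {i : Fin r} (h : r ≤ i + t) :
    staircaseBlock y x t i = y i :=
  dif_neg h.not_gt

theorem IsStaircase.block_mem (hx : IsStaircase G W κ y x) (hy : ∀ i, y i ∈ W) (t : ℕ)
    (i : Fin r) : staircaseBlock y x t i ∈ W := by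
  unfold staircaseBlock
  split_ifs
  exacts [hx.mem _ i, hy i]

theorem IsStaircase.block_adj (hx : IsStaircase G W κ y x) (hy : IsOrderedClique G y) (t : ℕ)
    {i j : Fin r} (hij : i < j) : G.Adj (staircaseBlock y x t i) (staircaseBlock y x t j) := by
  rw [Fin.lt_def] at hij
  unfold staircaseBlock
  split_ifs with hi hj hj
  · exact hx.adj hij
  · exact (hx.adj_target (by dsimp only; omega) hij.le (not_lt.1 hj)).symm
  · omega
  · exact hy i j (Fin.ne_of_lt hij)

theorem IsStaircase.block_adj_succ (hx : IsStaircase G W κ y x) (hy : IsOrderedClique G y) (t : ℕ)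
    {i j : Fin r} (hji : j < i) :
    G.Adj (staircaseBlock y x t i) (staircaseBlock y x (t + 1) j) := by
  rw [Fin.lt_def] at hji
  unfold staircaseBlock
  split_ifs with hi hj hj
  · exact hx.adj_succ rfl hji hi
  · omega
  · exact hx.adj_target (by dsimp only; omega) hji.le (by dsimp only; omega)
  · exact hy i j (Fin.ne_of_gt hji)

theorem IsStaircase.start_adj_block (hx : IsStaircase G W κ y x) {i j : Fin r} (hij : i ≤ j) :
    G.Adj (κ j) (staircaseBlock y x 0 i) := by
  rw [staircaseBlock, dif_pos (by omega)]
  exact hx.start_adj rfl hij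

end Block

/-- The data of a walk from `a` to `b` in `W`: a clique `y` in `W` and staircases to it from both
ends. On the right end cliques are read backwards, which makes the two ends symmetric. -/
structure IsScaffold (G : SimpleGraph V) (W : Finset V) (a b y : Fin r → V)
    (x z : Fin r → Fin r → V) : Prop where
  mem : ∀ i, y i ∈ W
  clique : IsOrderedClique G y
  left : IsStaircase G W a y x
  right : IsStaircase G W (b ∘ Fin.rev) (y ∘ Fin.rev) z

section Glue

variable {y : Fin r → V} {x z : Fin r → Fin r → V} (h : IsScaffold G W a b y x z) {N : ℕ}
include h

theorem IsScaffold.gluedBlock_mem (t : ℕ) (i : Fin r) : gluedBlock y x z N t i ∈ W := by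
  unfold gluedBlock
  split_ifs
  exacts [h.left.block_mem h.mem t i, h.right.block_mem (fun i => h.mem i.rev) _ _]

theorem IsScaffold.gluedBlock_adj (t : ℕ) {i j : Fin r} (hij : i < j) :
    G.Adj (gluedBlock y x z N t i) (gluedBlock y x z N t j) := by
  unfold gluedBlock
  split_ifs
  exacts [h.left.block_adj h.clique t hij,
    (h.right.block_adj h.clique.comp_rev _ (Fin.rev_lt_rev.2 hij)).symm]

theorem IsScaffold.gluedBlock_adj_succ (hN : 2 * r ≤ N) {t : ℕ} (ht : t + 1 < N) {i j : Fin r}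
    (hji : j < i) : G.Adj (gluedBlock y x z N t i) (gluedBlock y x z N (t + 1) j) := by
  unfold gluedBlock
  split_ifs with h₁ h₂ h₂
  · exact h.left.block_adj_succ h.clique t hji
  · rw [staircaseBlock_eq_target (by omega),
      staircaseBlock_eq_target (by rw [Fin.val_rev]; omega), Function.comp_apply, Fin.rev_rev]
    exact h.clique i j hji.ne'
  · omega
  · have := h.right.block_adj_succ h.clique.comp_rev (N - 1 - (t + 1)) (Fin.rev_lt_rev.2 hji)
    rw [show N - 1 - (t + 1) + 1 = N - 1 - t by omega] at this
    exact this.symm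

theorem IsScaffold.adj_gluedBlock_zero {i j : Fin r} (hij : i ≤ j) :
    G.Adj (a j) (gluedBlock y x z N 0 i) := by
  rw [gluedBlock, if_pos (by omega)]
  exact h.left.start_adj_block hij

theorem IsScaffold.gluedBlock_last_adj (hN : r ≤ N) {i j : Fin r} (hji : j ≤ i) :
    G.Adj (gluedBlock y x z (N + 1) N i) (b j) := by
  rw [gluedBlock, if_neg hN.not_gt, Nat.add_sub_cancel, Nat.sub_self]
  simpa using (h.right.start_adj_block (Fin.rev_le_rev.2 hji)).symm

theorem IsScaffold.gluedWalk_adj (hN : 2 * r ≤ N) {m m' : Fin (r * N)} (hlt : m < m')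
    (hd : (m' : ℕ) < m + r) : G.Adj (gluedWalk y x z m) (gluedWalk y x z m') := by
  rw [Fin.lt_def] at hlt
  have hr : 0 < r := by omega
  have hm := Nat.div_add_mod (m : ℕ) r
  have hm' := Nat.div_add_mod (m' : ℕ) r
  unfold gluedWalk
  rcases (Nat.div_le_div_right hlt.le : (m : ℕ) / r ≤ m' / r).eq_or_lt with same | next
  · rw [← same] at hm' ⊢
    refine h.gluedBlock_adj _ ?_
    rw [Fin.lt_def, Fin.coe_modNat, Fin.coe_modNat, Fin.val_cast, Fin.val_cast]
    omega
  · have hle : (m' : ℕ) / r ≤ m / r + 1 := by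
      rw [← Nat.add_div_right _ hr]
      exact Nat.div_le_div_right hd.le
    have hsucc : (m' : ℕ) / r = m / r + 1 := by omega
    have hlast : (m' : ℕ) / r < N := Nat.div_lt_of_lt_mul m'.2
    rw [hsucc] at hm' hlast ⊢
    rw [mul_add] at hm'
    refine h.gluedBlock_adj_succ hN hlast ?_
    rw [Fin.lt_def, Fin.coe_modNat, Fin.coe_modNat, Fin.val_cast, Fin.val_cast]
    omega

theorem IsScaffold.adj_gluedWalk {m : Fin (r * N)} {j : Fin r} (hmj : (m : ℕ) ≤ j) :
    G.Adj (a j) (gluedWalk y x z m) := by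
  have hlt : (m : ℕ) < r := by omega
  rw [gluedWalk, Nat.div_eq_of_lt hlt]
  refine h.adj_gluedBlock_zero ?_
  rw [Fin.le_def]
  simpa [Nat.mod_eq_of_lt hlt] using hmj

theorem IsScaffold.gluedWalk_adj_right (hN : 2 * r ≤ N) {m : Fin (r * N)} {j : Fin r}
    (hmj : r * N + j ≤ m + r) : G.Adj (gluedWalk y x z m) (b j) := by
  have hr : 0 < r := by omega
  obtain ⟨N, rfl⟩ : ∃ N', N = N' + 1 := ⟨N - 1, by omega⟩
  have hm : (m : ℕ) < r * N + r := m.2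
  have hmj' : r * N + r + j ≤ m + r := hmj
  have hdiv : (m : ℕ) / r = N := by
    rw [Nat.div_eq_iff hr, mul_comm N r]
    omega
  have hmod := Nat.div_add_mod (m : ℕ) r
  rw [hdiv] at hmod
  rw [gluedWalk, hdiv]
  refine h.gluedBlock_last_adj (by omega) ?_
  rw [Fin.le_def, Fin.coe_modNat, Fin.val_cast]
  omega

theorem IsScaffold.isSparseWalk_gluedWalk (hN : 2 * r ≤ N) :
    IsSparseWalk G W a b (gluedWalk (N := N) y x z) where
  mem _ := h.gluedBlock_mem _ _
  adj _ _ := h.gluedWalk_adj hN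
  left_adj _ _ := h.adj_gluedWalk
  adj_right _ _ := h.gluedWalk_adj_right hN

end Glue

/-- The entries of the clique and of the two staircases of a scaffold. -/
abbrev ScaffoldIndex (r : ℕ) : Type := Fin r ⊕ (Fin r × Fin r) ⊕ (Fin r × Fin r)

theorem HasDenseCommonNeighbors.le_density_isScaffold [Fintype V] {c : ℝ} (hc : 0 ≤ c)
    (hG : HasDenseCommonNeighbors G W r c) (a b : Fin r → V) :
    c ^ r * ((c ^ r) ^ r * (c ^ r) ^ r) ≤ density fun h : ScaffoldIndex r → V =>
      IsScaffold G W a b (fun i => h (.inl i)) (fun s i => h (.inr (.inl (s, i))))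
        (fun s i => h (.inr (.inr (s, i)))) := by
  let e : (ScaffoldIndex r → V) ≃ (Fin r → V) × (Fin r → Fin r → V) × (Fin r → Fin r → V) :=
    (Equiv.sumArrowEquivProdArrow ..).trans ((Equiv.refl _).prodCongr
      ((Equiv.sumArrowEquivProdArrow ..).trans ((Equiv.curry ..).prodCongr (Equiv.curry ..))))
  calc c ^ r * ((c ^ r) ^ r * (c ^ r) ^ r)
    _ ≤ density fun p : (Fin r → V) × (Fin r → Fin r → V) × (Fin r → Fin r → V) =>
          IsScaffold G W a b p.1 p.2.1 p.2.2 :=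
        mul_le_density_prod (by positivity) (hG.pow_le_density_isNextBlock hc a) fun y hy =>
          mul_le_density_prod (by positivity) (hG.pow_le_density_isStaircase hc a y) fun x hx =>
            (hG.pow_le_density_isStaircase hc (b ∘ Fin.rev) (y ∘ Fin.rev)).trans
              (density_mono fun z hz => ⟨hy.mem, hy.isOrderedClique, hx, hz⟩)
    _ = _ := (density_equiv e fun p => IsScaffold G W a b p.1 p.2.1 p.2.2).symm

theorem HasDenseCommonNeighbors.le_density_isSparseWalk [Fintype V] [Nonempty V] {c : ℝ}
    (hc : 0 ≤ c) (hG : HasDenseCommonNeighbors G W r c) (hr : 0 < r) {N : ℕ} (hN : 2 * r ≤ N)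
    (a b : Fin r → V) :
    (c ^ r * ((c ^ r) ^ r * (c ^ r) ^ r)) ^ (r * N) ^ Fintype.card (ScaffoldIndex r) ≤
      density fun x : Fin (r * N) → V => IsSparseWalk G W a b x := by
  let φ : Fin (r * N) → ScaffoldIndex r :=
    gluedWalk .inl (fun s i => .inr (.inl (s, i))) (fun s i => .inr (.inr (s, i)))
  calc _ ≤ _ := by gcongr; exact hG.le_density_isScaffold hc a b
    _ ≤ density (IsBlowup _ φ) :=
        density_pow_le_density_isBlowup _ (Nat.mul_ne_zero hr.ne' (by omega)) φ
    _ ≤ _ := density_mono fun x hx => IsBlowup.isSparseWalk (fun h hh => ?_) hx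
  rw [comp_gluedWalk]
  exact hh.isSparseWalk_gluedWalk hN

theorem exists_le_density_injective_isSparseWalk {r N : ℕ} (hr : 0 < r) (hN : 2 * r ≤ N) {c : ℝ}
    (hc : 0 < c) :
    ∃ β > 0, ∃ n₀ : ℕ, ∀ (V : Type*) [Fintype V] [Nonempty V], n₀ ≤ Fintype.card V →
      ∀ (G : SimpleGraph V) (W : Finset V), HasDenseCommonNeighbors G W r c →
        ∀ a b : Fin r → V, β ≤ density fun x : Fin (r * N) → V =>
          IsSparseWalk G W a b x ∧ x.Injective := by
  set δ := (c ^ r * ((c ^ r) ^ r * (c ^ r) ^ r)) ^ (r * N) ^ Fintype.card (ScaffoldIndex r)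
  have : 0 < δ := by positivity
  refine ⟨δ / 2, by positivity, ⌈((r * N : ℕ) : ℝ) ^ 2 / (δ / 2)⌉₊, fun V _ _ hV G W hG a b => ?_⟩
  have hcard : (0 : ℝ) < Fintype.card V := by exact_mod_cast Fintype.card_pos
  have repeats : ((r * N : ℕ) : ℝ) ^ 2 / Fintype.card V ≤ δ / 2 :=
    (div_le_comm₀ hcard (by positivity)).2 (Nat.ceil_le.1 hV)
  have walks := hG.le_density_isSparseWalk hc.le hr hN a b
  have inj := one_sub_sq_div_le_density_injective V (r * N)
  have both := density_add_density_sub_one_le_density_and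
    (fun x : Fin (r * N) → V => IsSparseWalk G W a b x) Function.Injective
  linarith

end Walks

open MeasureTheory SimpleGraph unitInterval

section RandomGraph

instance {V : Type*} [Finite V] : MeasurableSingletonClass (SimpleGraph V) where
  measurableSet_singleton Γ := by
    have : ({Γ} : Set (SimpleGraph V)) = edgeSet ⁻¹' {Γ.edgeSet} := by
      ext Γ'
      simp
    rw [this]
    exact measurable_edgeSet (Set.toFinite _).measurableSet

theorem measure_ext_of_Iic {α : Type*} [SemilatticeInf α] [OrderTop α] [Countable α]
    [MeasurableSpace α] [DiscreteMeasurableSpace α] {μ ν : Measure α} [IsFiniteMeasure μ]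
    (h : ∀ a, μ (Set.Iic a) = ν (Set.Iic a)) : μ = ν := by
  refine ext_of_generate_finite (Set.range Set.Iic)
    (le_antisymm (fun s _ => ?_) fun _ _ => .of_discrete) ?_
    (by rintro _ ⟨a, rfl⟩; exact h a) (by simpa using h ⊤)
  · have singleton (a : α) : MeasurableSet[.generateFrom (Set.range Set.Iic)] {a} := by
      have : ({a} : Set α) = Set.Iic a \ ⋃ b ∈ Set.Iio a, Set.Iic b := by
        ext c
        simp only [Set.mem_singleton_iff, Set.mem_sdiff, Set.mem_Iic, Set.mem_iUnion₂, Set.mem_Iio,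
          exists_prop, not_exists, not_and]
        refine ⟨by rintro rfl; exact ⟨le_rfl, fun b hb => hb.not_ge⟩, fun h => ?_⟩
        exact h.1.eq_or_lt.resolve_right fun hlt => h.2 c hlt le_rfl
      rw [this]
      exact .diff (.basic _ ⟨a, rfl⟩)
        (.biUnion (Set.to_countable _) fun b _ => .basic _ ⟨b, rfl⟩)
    rw [← Set.biUnion_of_singleton s]
    exact .biUnion (Set.to_countable s) fun a _ => singleton a
  · rintro _ ⟨a, rfl⟩ _ ⟨b, rfl⟩ -
    exact ⟨a ⊓ b, Set.Iic_inter_Iic.symm⟩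

variable {V : Type*}

theorem binomialRandom_real_disjoint [Finite V] (p : I) (H : SimpleGraph V) :
    (binomialRandom V p).real {Γ | Disjoint Γ H} = (1 - p : ℝ) ^ H.edgeSet.ncard := by
  lift H.edgeSet to Finset (Sym2 V) using Set.toFinite _ with D hD
  have loopless : ∀ e ∈ D, ¬ e.IsDiag := fun e he =>
    H.not_isDiag_of_mem_edgeSet (hD ▸ Finset.mem_coe.2 he)
  have preimage : (fun f : Sym2 V → Prop => fromEdgeSet {e | f e}) ⁻¹' {Γ | Disjoint Γ H} =
      Set.pi D fun _ => {False} := by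
    ext f
    simp only [Set.mem_preimage, Set.mem_ofPred_eq, ← disjoint_edgeSet, edgeSet_fromEdgeSet, ← hD,
      Set.disjoint_right, Set.mem_pi, Set.mem_singleton_iff, Finset.mem_coe]
    exact forall₂_congr fun e he => by simp [loopless e he]
  have hs : Measurable fun f : Sym2 V → Prop => {e | f e} := MeasurableEquiv.setOfPred.measurable
  rw [binomialRandom_eq_map, ProbabilityTheory.setBernoulli_eq_map,
    Measure.map_map (by fun_prop) hs, measureReal_def,
    Measure.map_apply (measurable_fromEdgeSet.comp hs) .of_discrete, Function.comp_def, preimage,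
    Measure.infinitePi_pi _ (by simp)]
  rw [Finset.prod_congr rfl (g := fun _ => (toNNReal (σ p) : ENNReal))]
  · simp
  · exact fun e he => by simp [loopless e he]

theorem binomialRandom_eq_map_sup [Finite V] {p q : I} (h : (1 - p : ℝ) = (1 - q) ^ 2) :
    binomialRandom V p =
      ((binomialRandom V q).prod (binomialRandom V q)).map fun x => x.1 ⊔ x.2 := by
  refine measure_ext_of_Iic fun H => ?_
  have Iic_eq (s : I) : binomialRandom V s (Set.Iic H) =
      ENNReal.ofReal ((1 - s : ℝ) ^ Hᶜ.edgeSet.ncard) := by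
    rw [← binomialRandom_real_disjoint, ofReal_measureReal]
    congr 1
    ext Γ
    exact (disjoint_compl_right_iff (x := Γ) (y := H)).symm
  have preimage : (fun x : SimpleGraph V × SimpleGraph V => x.1 ⊔ x.2) ⁻¹' Set.Iic H =
      Set.Iic H ×ˢ Set.Iic H := by
    ext x
    simp only [Set.mem_preimage, Set.mem_Iic, sup_le_iff, Set.mem_prod]
  rw [Measure.map_apply .of_discrete .of_discrete, preimage, Measure.prod_prod, Iic_eq, Iic_eq, h,
    ← ENNReal.ofReal_mul (by have := q.2.2; positivity), ← pow_mul, two_mul, pow_add]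

theorem exists_half_density (p : I) : ∃ q : I, (1 - p : ℝ) = (1 - q) ^ 2 ∧ (p : ℝ) / 2 ≤ q := by
  have sq_sqrt : √(1 - p : ℝ) ^ 2 = 1 - p := Real.sq_sqrt (sub_nonneg.2 p.2.2)
  have sqrt_le : √(1 - p : ℝ) ≤ 1 - p / 2 :=
    Real.sqrt_le_iff.2 ⟨by linarith [p.2.2], by nlinarith [sq_nonneg (p : ℝ)]⟩
  refine ⟨⟨1 - √(1 - p : ℝ), ?_, ?_⟩, ?_, ?_⟩
  · linarith [p.2.1]
  · linarith [Real.sqrt_nonneg (1 - p : ℝ)]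
  · simpa using sq_sqrt.symm
  · simpa using (by linarith : (p : ℝ) / 2 ≤ 1 - √(1 - p : ℝ))

theorem measureReal_prod_le {Ω Ω' : Type*} [MeasurableSpace Ω] [MeasurableSpace Ω']
    {μ : Measure Ω} {ν : Measure Ω'} [IsProbabilityMeasure μ] [IsProbabilityMeasure ν]
    {E : Set (Ω × Ω')} (hE : MeasurableSet E) {B : Set Ω} (hBm : MeasurableSet B) {b c : ℝ}
    (hB : μ.real B ≤ b) (hc : 0 ≤ c) (h : ∀ ω ∉ B, ν.real (Prod.mk ω ⁻¹' E) ≤ c) :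
    (μ.prod ν).real E ≤ b + c := by
  have fiber_le (ω : Ω) : ν.real (Prod.mk ω ⁻¹' E) ≤ B.indicator 1 ω + c := by
    by_cases hω : ω ∈ B
    · simpa [hω] using measureReal_le_one.trans (le_add_of_nonneg_right hc)
    · simpa [hω] using h ω hω
  have integrable_indicator : Integrable (B.indicator (1 : Ω → ℝ)) μ :=
    (integrable_const 1).indicator hBm
  calc (μ.prod ν).real E = ∫ ω, ν.real (Prod.mk ω ⁻¹' E) ∂μ := by
        simp only [measureReal_def]
        rw [Measure.prod_apply hE, integral_toReal (measurable_measure_prodMk_left hE).aemeasurable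
          (.of_forall fun _ => measure_lt_top _ _)]
    _ ≤ ∫ ω, (B.indicator 1 ω + c) ∂μ :=
        integral_mono_of_nonneg (.of_forall fun _ => measureReal_nonneg)
          (integrable_indicator.add (integrable_const c)) (.of_forall fiber_le)
    _ = μ.real B + c := by
        rw [integral_add integrable_indicator (integrable_const c), integral_indicator_one hBm]
        simp
    _ ≤ b + c := by gcongr

theorem measureReal_le_card_mul {Ω ι : Type*} [MeasurableSpace Ω] {μ : Measure Ω}
    [IsFiniteMeasure μ] {s : Finset ι} {E : Set Ω} {B : ι → Set Ω}
    (hE : ∀ ω ∈ E, ∃ i ∈ s, ω ∈ B i) {b : ℝ} (hB : ∀ i ∈ s, μ.real (B i) ≤ b) :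
    μ.real E ≤ s.card * b :=
  calc μ.real E ≤ μ.real (⋃ i ∈ s, B i) :=
        measureReal_mono (fun ω hω => by simpa using hE ω hω) (measure_ne_top _ _)
    _ ≤ ∑ i ∈ s, μ.real (B i) := measureReal_biUnion_finset_le _ _
    _ ≤ s.card * b := by simpa using Finset.sum_le_sum hB

end RandomGraph

section Expansion

theorem two_pow_le_exp (n : ℕ) : (2 : ℝ) ^ n ≤ Real.exp n := by
  rw [← mul_one (n : ℝ), Real.exp_nat_mul]
  gcongr
  linarith [Real.add_one_le_exp 1]

variable {V : Type*} [Fintype V]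

theorem card_filter_le_two_mul_ncard_edgeSet_fromRel_add_card (S : V → V → Prop)
    [DecidableRel S] :
    Finset.card {z : V × V | S z.1 z.2} ≤ 2 * (fromRel S).edgeSet.ncard + Fintype.card V := by
  classical
  have subset : ({z : V × V | S z.1 z.2} : Finset (V × V)) ⊆
      Finset.univ.image (fun d : (fromRel S).Dart => d.toProd) ∪
        Finset.univ.image fun v => (v, v) := by
    rintro ⟨v, u⟩ hS
    rw [Finset.mem_filter_univ] at hS
    rcases eq_or_ne v u with rfl | hne
    · exact Finset.mem_union_right _ (Finset.mem_image_of_mem _ (Finset.mem_univ v))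
    · exact Finset.mem_union_left _
        (Finset.mem_image.2 ⟨⟨(v, u), hne, Or.inl hS⟩, Finset.mem_univ _, rfl⟩)
  rw [← coe_edgeFinset, Set.ncard_coe_finset, ← dart_card_eq_twice_card_edges]
  exact (Finset.card_le_card subset).trans ((Finset.card_union_le _ _).trans
    (Nat.add_le_add Finset.card_image_le Finset.card_image_le))

theorem binomialRandom_real_disjoint_fromRel_le (p : I) {S : V → V → Prop} {δ : ℝ}
    (hS : δ ≤ density fun z : V × V => S z.1 z.2) :
    (binomialRandom V p).real {Γ | Disjoint Γ (fromRel S)} ≤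
      Real.exp (-(p * (δ * Fintype.card V ^ 2 - Fintype.card V) / 2)) := by
  classical
  have edges : (δ * Fintype.card V ^ 2 - Fintype.card V) / 2 ≤
      ((fromRel S).edgeSet.ncard : ℝ) := by
    have pairs : δ * Fintype.card V ^ 2 ≤ Finset.card {z : V × V | S z.1 z.2} := by
      rw [← density_mul_card, Fintype.card_prod, Nat.cast_mul, ← sq]
      gcongr
    have := pairs.trans (Nat.cast_le.2 (card_filter_le_two_mul_ncard_edgeSet_fromRel_add_card S))
    push_cast at this
    linarith
  have one_sub_nonneg : (0 : ℝ) ≤ 1 - p := sub_nonneg.2 p.2.2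
  calc (binomialRandom V p).real {Γ | Disjoint Γ (fromRel S)}
      = (1 - p : ℝ) ^ (fromRel S).edgeSet.ncard := binomialRandom_real_disjoint p _
    _ ≤ Real.exp (-p) ^ (fromRel S).edgeSet.ncard := by
        gcongr
        exact Real.one_sub_le_exp_neg p
    _ = Real.exp (-(p * (fromRel S).edgeSet.ncard)) := by
        rw [← Real.exp_nat_mul]
        ring_nf
    _ ≤ _ := by
        rw [mul_div_assoc]
        have := p.2.1
        gcongr

theorem exists_disjoint_fromRel_of_density_lt [Nonempty V] {Γ : SimpleGraph V}
    {S : V → V → Prop} {δ : ℝ} (hS : 2 * δ ≤ density fun z : V × V => S z.1 z.2)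
    (hΓ : density (fun v => ∃ u, S v u ∧ Γ.Adj v u) < δ) :
    ∃ U : Finset V, δ ≤ density (fun z : V × V => z.1 ∈ U ∧ S z.1 z.2) ∧
      Disjoint Γ (fromRel fun v u => v ∈ U ∧ S v u) := by
  classical
  refine ⟨({v | ¬ ∃ u, S v u ∧ Γ.Adj v u} : Finset V), ?_, ?_⟩
  · have cover := density_le_density_add_density (P := fun z : V × V => S z.1 z.2)
      (Q := fun z => ∃ u, S z.1 u ∧ Γ.Adj z.1 u)
      (R := fun z => z.1 ∈ ({v | ¬ ∃ u, S v u ∧ Γ.Adj v u} : Finset V) ∧ S z.1 z.2)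
      fun z hz => or_iff_not_imp_left.2 fun h => ⟨(Finset.mem_filter_univ _).2 h, hz⟩
    rw [density_prod_fst (α := V) (β := V) fun v => ∃ u, S v u ∧ Γ.Adj v u] at cover
    linarith
  · rw [disjoint_left]
    rintro v u hadj ⟨-, ⟨hv, hS⟩ | ⟨hu, hS⟩⟩
    · exact (Finset.mem_filter_univ _).1 hv ⟨u, hS, hadj⟩
    · exact (Finset.mem_filter_univ _).1 hu ⟨v, hS, hadj.symm⟩

theorem binomialRandom_real_density_exists_adj_lt_le [Nonempty V] {p : I} {S : V → V → Prop}
    {A δ : ℝ} (hA : 0 ≤ A) (hδ : 0 < δ) (hp : 4 * (A + 1) / δ ≤ p * Fintype.card V)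
    (hS : 2 * δ ≤ density fun z : V × V => S z.1 z.2) :
    (binomialRandom V p).real {Γ | density (fun v => ∃ u, S v u ∧ Γ.Adj v u) < δ} ≤
      Real.exp (-(A * Fintype.card V)) := by
  set n : ℝ := (Fintype.card V : ℝ)
  let sparse (U : Finset V) : Set (SimpleGraph V) :=
    {Γ | Disjoint Γ (fromRel fun v u => v ∈ U ∧ S v u)}
  let heavy : Finset (Finset V) := {U | δ ≤ density fun z : V × V => z.1 ∈ U ∧ S z.1 z.2}
  have cover : ∀ Γ : SimpleGraph V, density (fun v => ∃ u, S v u ∧ Γ.Adj v u) < δ →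
      ∃ U ∈ heavy, Γ ∈ sparse U := fun Γ hΓ => by
    obtain ⟨U, hU, hΓU⟩ := exists_disjoint_fromRel_of_density_lt hS hΓ
    exact ⟨U, (Finset.mem_filter_univ U).2 hU, hΓU⟩
  have exponent : (A + 1) * n ≤ p * (δ * n ^ 2 - n) / 2 := by
    have hpn : 4 * (A + 1) ≤ p * n * δ := (div_le_iff₀ hδ).1 hp
    have hn0 : 0 ≤ n := Nat.cast_nonneg _
    have hpn1 : (p : ℝ) * n ≤ n := mul_le_of_le_one_left hn0 p.2.2
    nlinarith [mul_le_mul_of_nonneg_right hpn hn0]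
  calc (binomialRandom V p).real {Γ | density (fun v => ∃ u, S v u ∧ Γ.Adj v u) < δ}
      ≤ heavy.card * Real.exp (-((A + 1) * n)) := measureReal_le_card_mul cover fun U hU =>
        (binomialRandom_real_disjoint_fromRel_le p ((Finset.mem_filter_univ U).1 hU)).trans
          (by gcongr)
    _ ≤ 2 ^ Fintype.card V * Real.exp (-((A + 1) * n)) := by
        gcongr
        exact_mod_cast (Finset.card_le_univ heavy).trans_eq Fintype.card_finset
    _ ≤ Real.exp n * Real.exp (-((A + 1) * n)) := by
        gcongr
        exact two_pow_le_exp _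
    _ = Real.exp (-(A * n)) := by
        rw [← Real.exp_add]
        ring_nf

theorem binomialRandom_real_density_prod_exists_adj_lt_le [Nonempty V] {Y : Type*} [Fintype Y]
    {p : I} {T : Y → V → V → Prop} {A β : ℝ} (hA : 0 ≤ A) (hβ : 0 < β)
    (hp : 16 * (A + 1) / β ≤ p * Fintype.card V)
    (hT : β ≤ density fun z : Y × V × V => T z.1 z.2.1 z.2.2) :
    (binomialRandom V p).real
        {Γ | density (fun z : Y × V => ∃ u, T z.1 z.2 u ∧ Γ.Adj z.2 u) < β ^ 2 / 8} ≤
      Fintype.card Y * Real.exp (-(A * Fintype.card V)) := by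
  let heavy : Finset Y := {y | β / 2 ≤ density fun z : V × V => T y z.1 z.2}
  have heavy_dense : β / 2 ≤ density fun y => y ∈ heavy := by
    simpa only [heavy, Finset.mem_filter_univ] using half_le_density_half_le_density hT
  let bad (y : Y) : Set (SimpleGraph V) :=
    {Γ | density (fun v => ∃ u, T y v u ∧ Γ.Adj v u) < β / 4}
  have bad_le (y : Y) (hy : y ∈ heavy) :
      (binomialRandom V p).real (bad y) ≤ Real.exp (-(A * Fintype.card V)) := by
    refine binomialRandom_real_density_exists_adj_lt_le hA (by positivity) (hp.trans_eq' ?_)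
      (((Finset.mem_filter_univ y).1 hy).trans_eq' ?_)
    · field_simp
      norm_num
    · ring
  have cover : ∀ Γ : SimpleGraph V,
      density (fun z : Y × V => ∃ u, T z.1 z.2 u ∧ Γ.Adj z.2 u) < β ^ 2 / 8 →
        ∃ y ∈ heavy, Γ ∈ bad y := fun Γ hΓ => by
    contrapose! hΓ
    calc β ^ 2 / 8 = β / 2 * (β / 4) := by ring
      _ ≤ density fun z : Y × V => ∃ u, T z.1 z.2 u ∧ Γ.Adj z.2 u :=
        mul_le_density_prod (by positivity) heavy_dense fun y hy => not_lt.1 (hΓ y hy)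
  refine (measureReal_le_card_mul cover bad_le).trans ?_
  gcongr
  exact Finset.card_le_univ heavy

theorem binomialRandom_real_density_pi_exists_adj_lt_le [Nonempty V] {j : ℕ} (i : Fin (j + 1))
    {p : I} {T : (Fin (j + 1) → V) → V → Prop} {A β : ℝ} (hA : 0 ≤ A) (hβ : 0 < β)
    (hp : 16 * (A + 1) / β ≤ p * Fintype.card V)
    (hT : β ≤ density fun z : (Fin (j + 1) → V) × V => T z.1 z.2) :
    (binomialRandom V p).real
        {Γ | density (fun x => ∃ u, T x u ∧ Γ.Adj (x i) u) < β ^ 2 / 8} ≤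
      Fintype.card V ^ j * Real.exp (-(A * Fintype.card V)) := by
  let e : (Fin j → V) × V ≃ (Fin (j + 1) → V) :=
    (Equiv.prodComm _ _).trans (Fin.insertNthEquiv (fun _ => V) i)
  have he (y : Fin j → V) (v : V) : e (y, v) i = v :=
    Fin.insertNth_apply_same (α := fun _ => V) i v y
  have expansion := binomialRandom_real_density_prod_exists_adj_lt_le hA hβ hp
    (T := fun y v u => T (e (y, v)) u) (by
      rwa [← density_equiv ((Equiv.prodAssoc _ _ _).symm.trans (e.prodCongr (.refl V)))] at hT)
  have density_eq (Γ : SimpleGraph V) :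
      density (fun x => ∃ u, T x u ∧ Γ.Adj (x i) u) =
        density fun z : (Fin j → V) × V => ∃ u, T (e (z.1, z.2)) u ∧ Γ.Adj z.2 u := by
    simp only [← density_equiv e, he]
  simpa [density_eq] using expansion

end Expansion

section Linked

/-- Some sequence satisfying `T` has any two of its entries at distance `r` adjacent in `Γ`: the
random graph supplies the edges that a sparse walk lacks. -/
def HasLinkedSequence {V : Type*} (r : ℕ) {j : ℕ} (T : (Fin j → V) → Prop) (Γ : SimpleGraph V) :
    Prop :=
  ∃ x, T x ∧ ∀ a b : Fin j, (b : ℕ) = a + r → Γ.Adj (x a) (x b)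

variable {V : Type*}

theorem HasLinkedSequence.snoc {r j : ℕ} {i : Fin j} (hi : (i : ℕ) + r = j)
    {T : (Fin (j + 1) → V) → Prop} {Γ₁ Γ₂ : SimpleGraph V}
    (h : HasLinkedSequence r
      (fun x => ∃ u, T (Fin.snoc (α := fun _ => V) x u) ∧ Γ₁.Adj (x i) u) Γ₂) :
    HasLinkedSequence r T (Γ₁ ⊔ Γ₂) := by
  obtain ⟨x, ⟨u, hu, hadj⟩, hlinked⟩ := h
  refine ⟨_, hu, fun a b hab => ?_⟩
  obtain ⟨a, rfl⟩ : ∃ a' : Fin j, a = a'.castSucc :=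
    ⟨⟨a, by have := b.2; have := i.2; omega⟩, rfl⟩
  induction b using Fin.lastCases with
  | last =>
    obtain rfl : a = i := by
      ext
      simp only [Fin.val_last, Fin.val_castSucc] at hab
      omega
    simpa using Or.inl hadj
  | cast b => simpa using Or.inr (hlinked a b (by simpa using hab))

variable [Fintype V]

theorem binomialRandom_real_not_hasLinkedSequence_eq_zero {r : ℕ} {T : (Fin r → V) → Prop}
    (hT : 0 < density T) (p : I) :
    (binomialRandom V p).real {Γ | ¬ HasLinkedSequence r T Γ} = 0 := by
  obtain ⟨x, hx⟩ := exists_of_density_pos hT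
  have linked (Γ : SimpleGraph V) : HasLinkedSequence r T Γ :=
    ⟨x, hx, fun a b hab => by omega⟩
  simp [linked]

/-- Expose the random graph in two rounds: the first joins the last entry to its predecessor at
distance `r`, the second links the remaining entries. -/
theorem binomialRandom_real_not_hasLinkedSequence_succ_le [Nonempty V] {r j : ℕ}
    (i : Fin (j + 1)) (hi : (i : ℕ) + r = j + 1) {p q : I} (hpq : (1 - p : ℝ) = (1 - q) ^ 2)
    {A β b : ℝ} (hA : 0 ≤ A) (hβ : 0 < β) (hq : 16 * (A + 1) / β ≤ q * Fintype.card V)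
    (hb : 0 ≤ b) (ih : ∀ T : (Fin (j + 1) → V) → Prop, β ^ 2 / 8 ≤ density T →
      (binomialRandom V q).real {Γ | ¬ HasLinkedSequence r T Γ} ≤ b)
    {T : (Fin (j + 2) → V) → Prop} (hT : β ≤ density T) :
    (binomialRandom V p).real {Γ | ¬ HasLinkedSequence r T Γ} ≤
      Fintype.card V ^ j * Real.exp (-(A * Fintype.card V)) + b := by
  have hT' : β ≤ density fun z : (Fin (j + 1) → V) × V =>
      T (Fin.snoc (α := fun _ => V) z.1 z.2) := by
    rwa [← density_equiv ((Equiv.prodComm _ _).trans (Fin.snocEquiv fun _ => V))] at hT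
  rw [binomialRandom_eq_map_sup hpq, map_measureReal_apply .of_discrete .of_discrete]
  refine measureReal_prod_le .of_discrete .of_discrete
    (binomialRandom_real_density_pi_exists_adj_lt_le i
      (T := fun x u => T (Fin.snoc (α := fun _ => V) x u)) hA hβ hq hT') hb fun Γ₁ hΓ₁ => ?_
  refine (measureReal_mono ?_).trans (ih _ (not_lt.1 hΓ₁))
  exact fun Γ₂ hΓ₂ h => hΓ₂ (h.snoc hi)

theorem exists_binomialRandom_real_not_hasLinkedSequence_le {r j : ℕ} (hr : 0 < r) (hj : r ≤ j)
    {A β : ℝ} (hA : 0 ≤ A) (hβ : 0 < β) :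
    ∃ C : ℝ, ∀ (V : Type*) [Fintype V] [Nonempty V] (T : (Fin j → V) → Prop), β ≤ density T →
      ∀ p : I, C ≤ p * Fintype.card V →
        (binomialRandom V p).real {Γ | ¬ HasLinkedSequence r T Γ} ≤
          j * Fintype.card V ^ j * Real.exp (-(A * Fintype.card V)) := by
  induction j, hj using Nat.le_induction generalizing β with
  | base =>
    refine ⟨0, fun V _ _ T hT p _ => ?_⟩
    rw [binomialRandom_real_not_hasLinkedSequence_eq_zero (hβ.trans_le hT)]
    positivity
  | succ j hj ih =>
    obtain ⟨j, rfl⟩ := Nat.exists_eq_add_one.2 (hr.trans_le hj)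
    obtain ⟨C, hC⟩ := ih (β := β ^ 2 / 8) (by positivity)
    refine ⟨2 * max C (16 * (A + 1) / β), fun V _ _ T hT p hp => ?_⟩
    obtain ⟨q, hpq, hq⟩ := exists_half_density p
    have hqC : max C (16 * (A + 1) / β) ≤ q * Fintype.card V := by
      have : (p : ℝ) / 2 * Fintype.card V ≤ q * Fintype.card V := by gcongr
      linarith
    have hn : (1 : ℝ) ≤ Fintype.card V := Nat.one_le_cast.2 Fintype.card_pos
    refine (binomialRandom_real_not_hasLinkedSequence_succ_le
      (i := ⟨j + 1 - r, by omega⟩) (Nat.sub_add_cancel hj) hpq hA hβ ((le_max_right _ _).trans hqC)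
      (by positivity) (fun T hT => hC V T hT q ((le_max_left _ _).trans hqC)) hT).trans ?_
    calc _ ≤ Fintype.card V ^ (j + 2) * Real.exp (-(A * Fintype.card V)) +
          (j + 1 : ℕ) * Fintype.card V ^ (j + 2) * Real.exp (-(A * Fintype.card V)) := by
          gcongr <;> first | exact hn | omega
      _ = _ := by
          push_cast
          ring

end Linked

section Sampling

open ProbabilityTheory

theorem tendsto_pow_mul_exp_neg_mul (m : ℕ) {η : ℝ} (hη : 0 < η) :
    Tendsto (fun n : ℕ => (n : ℝ) ^ m * Real.exp (-(η * n))) atTop (𝓝 0) := by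
  refine (tendsto_pow_const_mul_const_pow_of_lt_one m (Real.exp_pos (-η)).le
    (Real.exp_lt_one_iff.2 (neg_lt_zero.2 hη))).congr fun n => ?_
  rw [← Real.exp_nat_mul]
  ring_nf

theorem measureReal_le_sum_mul_sub_integral_le {Ω V : Type*} [MeasurableSpace Ω] [Fintype V]
    {μ : Measure Ω} [IsProbabilityMeasure μ] {X : V → Ω → ℝ} (hindep : iIndepFun X μ)
    (hmeas : ∀ v, AEMeasurable (X v) μ) (hX : ∀ v ω, X v ω ∈ Set.Icc 0 1) {w : V → ℝ}
    (hw : ∀ v, |w v| ≤ 1) {t : ℝ} (ht : 0 ≤ t) :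
    μ.real {ω | t ≤ ∑ v, w v * (X v ω - μ[X v])} ≤
      Real.exp (-t ^ 2 / (2 * Fintype.card V)) := by
  have indep : iIndepFun (fun v ω => w v * (X v ω - μ[X v])) μ :=
    hindep.comp (fun v (x : ℝ) => w v * (x - ∫ ω, X v ω ∂μ)) fun v => by fun_prop
  have subgaussian (v : V) : HasSubgaussianMGF (fun ω => w v * (X v ω - μ[X v])) 1 μ := by
    have bounded (ω : Ω) : w v * X v ω ∈ Set.Icc (-1) 1 := abs_le.1 <| by
      rw [abs_mul]
      exact mul_le_one₀ (hw v) (abs_nonneg _) (abs_le.2 ⟨by linarith [(hX v ω).1], (hX v ω).2⟩)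
    have := hasSubgaussianMGF_of_mem_Icc ((hmeas v).const_mul (w v)) (.of_forall bounded)
    simp only [integral_const_mul, ← mul_sub] at this
    convert! this using 1
    ext
    norm_num
  simpa using HasSubgaussianMGF.measure_sum_ge_le_of_iIndepFun indep
    (s := Finset.univ) (fun v _ => subgaussian v) ht

theorem exists_finset_forall_sum_mul_indicator_sub_lt {V κ : Type*} [Fintype V] [Fintype κ]
    (p : I) {w : κ → V → ℝ} (hw : ∀ k v, |w k v| ≤ 1) {t : ℝ} (ht : 0 ≤ t)
    (hlt : Fintype.card κ * Real.exp (-t ^ 2 / (2 * Fintype.card V)) < 1) :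
    ∃ s : Finset V, ∀ k, ∑ v, w k v * ((s : Set V).indicator (1 : V → ℝ) v - p) < t := by
  let X (v : V) (ω : V → I) : ℝ := (Set.Iic p).indicator (1 : I → ℝ) (ω v)
  have measurable_X : Measurable ((Set.Iic p).indicator (1 : I → ℝ)) :=
    measurable_one.indicator measurableSet_Iic
  have integral_X (v : V) : ∫ ω, X v ω = p := by
    calc ∫ ω, X v ω = ∫ x, (Set.Iic p).indicator (1 : I → ℝ) x :=
          integral_comp_eval (X := fun _ => I) (i := v) measurable_X.aestronglyMeasurable
      _ = p := by
        rw [integral_indicator_one measurableSet_Iic, measureReal_def, unitInterval.volume_Iic,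
          ENNReal.toReal_ofReal p.2.1]
  have indep : iIndepFun X volume := iIndepFun_pi fun _ => measurable_X.aemeasurable
  have mem_Icc (v : V) (ω : V → I) : X v ω ∈ Set.Icc 0 1 := by
    by_cases h : ω v ∈ Set.Iic p <;> simp [X, h]
  have tail (k : κ) := measureReal_le_sum_mul_sub_integral_le indep
    (fun v => (measurable_X.comp (measurable_pi_apply v)).aemeasurable) mem_Icc (hw k) ht
  simp only [integral_X] at tail
  have bad_lt_one : (volume : Measure (V → I)).real
      {ω | ∃ k, t ≤ ∑ v, w k v * (X v ω - p)} < 1 :=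
    (measureReal_le_card_mul (s := Finset.univ) (by simp) fun k _ => tail k).trans_lt hlt
  obtain ⟨ω, hω⟩ : ∃ ω : V → I, ∀ k, ∑ v, w k v * (X v ω - p) < t := by
    by_contra! h
    simp [h] at bad_lt_one
  refine ⟨({v | ω v ≤ p} : Finset V), fun k => ?_⟩
  simpa [X, Set.indicator_apply] using hω k

/-- Sample with density slightly above `ρ`, so that the sample exceeds the required size, and
then shrink it. -/
theorem eventually_exists_card_eq_forall_card_inter_le {ρ κ : ℝ} (hρ₀ : 0 ≤ ρ) (hρ₁ : ρ < 1)
    (hκ : 0 < κ) :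
    ∀ᶠ n : ℕ in atTop, ∀ B : Fin n → Finset (Fin n), ∃ R : Finset (Fin n),
      R.card = ⌊ρ * n⌋₊ ∧ ∀ v, ((R ∩ B v).card : ℝ) ≤ ρ * (B v).card + κ * n := by
  obtain ⟨η, hη₀, hη⟩ : ∃ η > 0, η ≤ min (1 - ρ) (κ / 2) :=
    ⟨_, lt_min (by linarith) (by linarith), le_rfl⟩
  obtain ⟨hηρ, hηκ⟩ := le_min_iff.1 hη
  let p : I := ⟨ρ + η, by linarith, by linarith⟩
  have exp_small : Tendsto (fun n : ℕ => (n + 1) * Real.exp (-(η ^ 2 / 2 * n))) atTop (𝓝 0) := by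
    simpa [add_mul] using (tendsto_pow_mul_exp_neg_mul 1 (by positivity : 0 < η ^ 2 / 2)).add
      (tendsto_pow_mul_exp_neg_mul 0 (by positivity : 0 < η ^ 2 / 2))
  filter_upwards [exp_small.eventually_lt_const one_pos, eventually_gt_atTop 0] with n hn hn₀ B
  have exponent : -(η * n) ^ 2 / (2 * n) = -(η ^ 2 / 2 * n) := by field_simp
  let w (k : Option (Fin n)) : Fin n → ℝ := k.elim (fun _ => -1) fun u => (B u : Set _).indicator 1
  obtain ⟨s, hs⟩ := exists_finset_forall_sum_mul_indicator_sub_lt p (w := w) (t := η * n)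
    (by
      rintro (_ | u) v
      · simp [w]
      · by_cases h : v ∈ B u <;> simp [w, h])
    (by positivity) (by rwa [Fintype.card_option, Fintype.card_fin, Nat.cast_add_one, exponent])
  have le_card : ρ * n ≤ s.card := by
    have := hs none
    simp only [w, p, Option.elim, neg_mul, one_mul, Set.indicator_apply, Finset.mem_coe,
      Pi.one_apply, Finset.sum_neg_distrib, Finset.sum_sub_distrib, Finset.sum_boole,
      Finset.filter_univ_mem, Finset.sum_const, Finset.card_univ, Fintype.card_fin,
      nsmul_eq_mul] at this
    linarith
  obtain ⟨R, hRs, hR⟩ := Finset.exists_subset_card_eq (Nat.floor_le_of_le le_card)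
  refine ⟨R, hR, fun u => ?_⟩
  have card_inter_lt : ((s ∩ B u).card : ℝ) - (B u).card * (ρ + η) < η * n := by
    simpa only [w, p, Option.elim, Set.indicator_apply, Finset.mem_coe, Pi.one_apply, ite_mul,
      one_mul, zero_mul, Finset.sum_ite_mem, Finset.univ_inter, Finset.sum_sub_distrib,
      Finset.sum_const, nsmul_eq_mul, mul_one, Finset.inter_comm s] using hs (some u)
  have card_inter_mono : ((R ∩ B u).card : ℝ) ≤ (s ∩ B u).card := by
    gcongr
  have card_le : ((B u).card : ℝ) ≤ n := by
    simpa using Finset.card_le_univ (B u)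
  nlinarith

end Sampling

section Reservoir

variable {V : Type*}

theorem card_filter_not_adj_add_minDegree_le [Fintype V] (G : SimpleGraph V) [DecidableRel G.Adj]
    (v : V) : Finset.card {u | ¬ G.Adj v u} + G.minDegree ≤ Fintype.card V := by
  have card_univ := Finset.card_filter_add_card_filter_not (s := Finset.univ) (G.Adj v)
  rw [← neighborFinset_eq_filter, card_neighborFinset_eq_degree, Finset.card_univ] at card_univ
  linarith [G.minDegree_le_degree v]

variable [DecidableEq V]

theorem hasDenseCommonNeighbors_sdiff [Fintype V] [Nonempty V] {G : SimpleGraph V}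
    [DecidableRel G.Adj] {R S : Finset V} {r : ℕ} {c d : ℝ}
    (hd : ∀ v, (Finset.card {u ∈ R | ¬ G.Adj v u} : ℝ) ≤ d)
    (hc : c * Fintype.card V ≤ R.card - S.card - r * d) :
    HasDenseCommonNeighbors G (R \ S) r c := by
  intro w
  let common : Finset V := {v | v ∈ R \ S ∧ ∀ j, G.Adj (w j) v}
  have cover : R ⊆ common ∪ S ∪ Finset.univ.biUnion fun j => {u ∈ R | ¬ G.Adj (w j) u} := by
    intro v hv
    by_cases hS : v ∈ S
    · simp [hS]
    · simp [common, hv, hS, forall_or_exists_not]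
  have card_cover : (R.card : ℝ) ≤ _ := Nat.cast_le.2 <|
    (Finset.card_le_card cover).trans <| (Finset.card_union_le _ _).trans <|
      Nat.add_le_add (Finset.card_union_le _ _) Finset.card_biUnion_le
  push_cast at card_cover
  have nonneighbors : ∑ j, (Finset.card {u ∈ R | ¬ G.Adj (w j) u} : ℝ) ≤ r * d := by
    simpa using Finset.sum_le_sum fun j (_ : j ∈ Finset.univ) => hd (w j)
  rw [← mul_le_mul_iff_left₀ (Nat.cast_pos.2 Fintype.card_pos : (0 : ℝ) < Fintype.card V),
    density_mul_card]
  linarith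

theorem eventually_exists_forall_hasDenseCommonNeighbors {r : ℕ} (hr : 0 < r) {ε ρ : ℝ}
    (hε : 0 < ε) (hρ₀ : 0 < ρ) (hρ₁ : ρ < 1) :
    ∀ᶠ n : ℕ in atTop, ∀ (G : SimpleGraph (Fin n)) [DecidableRel G.Adj],
      (1 - 1 / r + ε) * n ≤ G.minDegree → ∃ R : Finset (Fin n), R.card = ⌊ρ * n⌋₊ ∧
        ∀ S : Finset (Fin n), (S.card : ℝ) ≤ ε * R.card / 4 →
          HasDenseCommonNeighbors G (R \ S) r (ε * ρ / 4) := by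
  filter_upwards [eventually_exists_card_eq_forall_card_inter_le hρ₀.le hρ₁
    (by positivity : 0 < ε * ρ / 4), eventually_gt_atTop 0,
    eventually_ge_atTop ⌈4 / (ε * ρ)⌉₊] with n hn hn₀ hn₄ G _ hG
  obtain ⟨R, hR, hRB⟩ := hn fun v => {u | ¬ G.Adj v u}
  have hr₁ : (1 : ℝ) ≤ r := Nat.one_le_cast.2 hr
  have le_card : ρ * n - 1 ≤ R.card := hR ▸ (Nat.sub_one_lt_floor _).le
  have card_le : (R.card : ℝ) ≤ ρ * n := hR ▸ Nat.floor_le (by positivity)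
  have large : 4 ≤ ε * ρ * n := (div_le_iff₀' (by positivity)).1 (Nat.ceil_le.1 hn₄)
  have : Nonempty (Fin n) := ⟨⟨0, hn₀⟩⟩
  have nonneighbors (v : Fin n) : (Finset.card {u ∈ R | ¬ G.Adj v u} : ℝ) ≤
      ρ * ((1 / r - ε) * n) + ε * ρ / 4 * n := by
    have : (Finset.card {u | ¬ G.Adj v u} : ℝ) ≤ (1 / r - ε) * n := by
      have : (Finset.card {u | ¬ G.Adj v u} : ℝ) + G.minDegree ≤ n := by
        exact_mod_cast (card_filter_not_adj_add_minDegree_le G v).trans_eq (Fintype.card_fin n)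
      linarith
    rw [← Finset.inter_univ R, ← Finset.inter_filter]
    exact (hRB v).trans (by gcongr)
  refine ⟨R, hR, fun S hS => hasDenseCommonNeighbors_sdiff nonneighbors ?_⟩
  have hd : (r : ℝ) * (ρ * ((1 / r - ε) * n) + ε * ρ / 4 * n) =
      ρ * n - 3 / 4 * (r * (ε * ρ * n)) := by
    field_simp
    ring
  have hr_mul : ε * ρ * n ≤ r * (ε * ρ * n) := le_mul_of_one_le_left (by positivity) hr₁
  have card_mul : ε * R.card ≤ ε * (ρ * n) := by gcongr
  rw [hd, Fintype.card_fin]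
  linarith

theorem exists_binomialRandom_real_not_isConnectedThrough_le {r N : ℕ} (hr : 0 < r)
    (hN : 2 * r ≤ N) {A c : ℝ} (hA : 0 ≤ A) (hc : 0 < c) :
    ∃ C : ℝ, ∃ n₀ : ℕ, ∀ (V : Type*) [Fintype V] [Nonempty V], n₀ ≤ Fintype.card V →
      ∀ (G : SimpleGraph V) (W : Finset V), HasDenseCommonNeighbors G W r c →
        ∀ p : I, C ≤ p * Fintype.card V → ∀ a b : Fin r → V,
          IsOrderedClique G a → IsOrderedClique G b →
            (∀ i, a i ∉ W) → (∀ i, b i ∉ W) → (∀ i j, a i ≠ b j) →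
              (binomialRandom V p).real {Γ | ¬ IsConnectedThrough (G ⊔ Γ) r (r * N) W a b} ≤
                (r * N : ℕ) * Fintype.card V ^ (r * N) * Real.exp (-(A * Fintype.card V)) := by
  have hrN : r ≤ r * N := Nat.le_mul_of_pos_right _ (by omega)
  obtain ⟨β, hβ, n₀, walks⟩ := exists_le_density_injective_isSparseWalk hr hN hc
  obtain ⟨C, linked⟩ := exists_binomialRandom_real_not_hasLinkedSequence_le hr hrN hA hβ
  refine ⟨C, n₀, fun V _ _ hV G W hG p hp a b ha hb haW hbW hab =>
    (measureReal_mono ?_ (measure_ne_top _ _)).trans (linked V _ (walks V hV G W hG a b) p hp)⟩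
  rintro Γ hΓ ⟨x, ⟨hx, hinj⟩, hxΓ⟩
  exact hΓ (hx.isConnectedThrough hinj hxΓ ha hb haW hbW hab hrN)

theorem binomialRandom_real_not_isReservoir_le {V : Type*} [Fintype V] [DecidableEq V] {k : ℕ}
    {ε : ℝ} {G : SimpleGraph V} {R : Finset V} {p : I} {b : ℝ} (hb₀ : 0 ≤ b)
    (hb : ∀ S ⊆ R, (S.card : ℝ) ≤ ε * R.card / 4 → ∀ K K' : Fin (k + 1) → V,
      IsOrderedClique G K → IsOrderedClique G K' → (∀ i, K i ∉ R) → (∀ i, K' i ∉ R) →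
        (∀ i j, K i ≠ K' j) → (binomialRandom V p).real {Γ | ¬ IsConnectedThrough (G ⊔ Γ) (k + 1)
          ((k + 1) * 2 ^ (k + 1)) (R \ S) K K'} ≤ b) :
    (binomialRandom V p).real {Γ | ¬ IsReservoir k ε G (G ⊔ Γ) R} ≤
      2 ^ Fintype.card V * Fintype.card V ^ (2 * (k + 1)) * b := by
  classical
  let bad (z : Finset V × (Fin (k + 1) → V) × (Fin (k + 1) → V)) : Set (SimpleGraph V) :=
    {Γ | ¬ IsConnectedThrough (G ⊔ Γ) (k + 1) ((k + 1) * 2 ^ (k + 1)) (R \ z.1) z.2.1 z.2.2}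
  let triples : Finset (Finset V × (Fin (k + 1) → V) × (Fin (k + 1) → V)) :=
    {z | z.1 ⊆ R ∧ (z.1.card : ℝ) ≤ ε * R.card / 4 ∧ IsOrderedClique G z.2.1 ∧
      IsOrderedClique G z.2.2 ∧ (∀ i, z.2.1 i ∉ R) ∧ (∀ i, z.2.2 i ∉ R) ∧
        ∀ i j, z.2.1 i ≠ z.2.2 j}
  have card_le : triples.card ≤ 2 ^ Fintype.card V * Fintype.card V ^ (2 * (k + 1)) :=
    (Finset.card_le_univ _).trans_eq (by simp [two_mul, pow_add])
  calc (binomialRandom V p).real {Γ | ¬ IsReservoir k ε G (G ⊔ Γ) R}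
      ≤ triples.card * b := by
        refine measureReal_le_card_mul (B := bad) (fun Γ hΓ => ?_) fun z hz => ?_
        · by_contra! h
          refine hΓ fun S hS hS' K K' hK hK' hKR hKR' hKK' => not_not.1 (h (S, K, K') ?_)
          exact (Finset.mem_filter_univ _).2 ⟨hS, hS', hK, hK', hKR, hKR', hKK'⟩
        · obtain ⟨hS, hS', hK, hK', hKR, hKR', hKK'⟩ := (Finset.mem_filter_univ z).1 hz
          exact hb _ hS hS' _ _ hK hK' hKR hKR' hKK'
    _ ≤ _ := by
        gcongr
        exact_mod_cast card_le

theorem exists_binomialRandom_real_not_isReservoir_le (k : ℕ) {c : ℝ} (hc : 0 < c) :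
    ∃ C M : ℝ, ∃ n₀ m : ℕ, ∀ (V : Type*) [Fintype V] [Nonempty V] [DecidableEq V],
      n₀ ≤ Fintype.card V → ∀ (G : SimpleGraph V) (R : Finset V) (ε : ℝ),
        (∀ S : Finset V, (S.card : ℝ) ≤ ε * R.card / 4 →
          HasDenseCommonNeighbors G (R \ S) (k + 1) c) →
        ∀ p : I, C ≤ p * Fintype.card V →
          (binomialRandom V p).real {Γ | ¬ IsReservoir k ε G (G ⊔ Γ) R} ≤
            M * (Fintype.card V ^ m * Real.exp (-Fintype.card V)) := by
  have hN : 2 * (k + 1) ≤ 2 ^ (k + 1) := by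
    have := Nat.lt_two_pow_self (n := k)
    omega
  obtain ⟨C, n₀, connected⟩ :=
    exists_binomialRandom_real_not_isConnectedThrough_le k.succ_pos hN zero_le_two hc
  set L := (k + 1) * 2 ^ (k + 1)
  refine ⟨C, L, n₀, 2 * (k + 1) + L, fun V _ _ _ hV G R ε hR p hp => ?_⟩
  set n : ℝ := (Fintype.card V : ℝ)
  calc (binomialRandom V p).real {Γ | ¬ IsReservoir k ε G (G ⊔ Γ) R}
      ≤ 2 ^ Fintype.card V * n ^ (2 * (k + 1)) * (L * n ^ L * Real.exp (-(2 * n))) :=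
        binomialRandom_real_not_isReservoir_le (by positivity)
          fun S _ hS K K' hK hK' hKR hKR' hKK' =>
            connected V hV G _ (hR S hS) p hp K K' hK hK'
              (fun i hi => hKR i (Finset.sdiff_subset hi))
              (fun i hi => hKR' i (Finset.sdiff_subset hi)) hKK'
    _ ≤ Real.exp n * n ^ (2 * (k + 1)) * (L * n ^ L * Real.exp (-(2 * n))) := by
        gcongr
        exact two_pow_le_exp _
    _ = L * (n ^ (2 * (k + 1) + L) * Real.exp (-n)) := by
        rw [show -(2 * n) = -n + -n by ring, Real.exp_add, Real.exp_neg n, pow_add]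
        field_simp

end Reservoir

theorem exists_finset_fin_card_eq_floor_mul (n : ℕ) {ρ : ℝ} (hρ : ρ ≤ 1) :
    ∃ R : Finset (Fin n), R.card = ⌊ρ * n⌋₊ := by
  have le_card : ⌊ρ * n⌋₊ ≤ (Finset.univ : Finset (Fin n)).card := by
    simpa using Nat.floor_le_of_le (mul_le_of_le_one_left n.cast_nonneg hρ)
  exact (Finset.exists_subset_card_eq le_card).imp fun _ => And.right

theorem exists_forall_and_eventually {ι : Type*} {l : Filter ι} {α : ι → Type*}
    {P Q : ∀ i, α i → Prop} (hP : ∀ i, ∃ x, P i x) (hPQ : ∀ᶠ i in l, ∃ x, P i x ∧ Q i x) :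
    ∃ x : ∀ i, α i, (∀ i, P i (x i)) ∧ ∀ᶠ i in l, Q i (x i) := by
  have (i : ι) : ∃ x, P i x ∧ ((∃ x, P i x ∧ Q i x) → Q i x) := by
    by_cases h : ∃ x, P i x ∧ Q i x
    · exact h.imp fun x hx => ⟨hx.1, fun _ => hx.2⟩
    · exact (hP i).imp fun x hx => ⟨hx, fun h' => absurd h' h⟩
  choose x hx hxQ using this
  exact ⟨x, hx, hPQ.mono hxQ⟩

theorem tendsto_measure_one_of_tendsto_measureReal_compl_zero {ι : Type*} {l : Filter ι}
    {Ω : ι → Type*} [∀ i, MeasurableSpace (Ω i)] {μ : ∀ i, Measure (Ω i)}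
    [∀ i, IsProbabilityMeasure (μ i)] {E : ∀ i, Set (Ω i)} (hE : ∀ i, MeasurableSet (E i))
    (h : Tendsto (fun i => (μ i).real (E i)ᶜ) l (𝓝 0)) :
    Tendsto (fun i => μ i (E i)) l (𝓝 1) := by
  have := ENNReal.tendsto_ofReal (h.const_sub 1)
  simpa [probReal_compl_eq_one_sub (hE _)] using this

theorem proposition2p2 (k : ℕ) (ε γ : ℝ) (hε : 0 < ε) (hγ₀ : 0 < γ) (hγ₁ : γ < 1) :
    ∃ C : ℝ, 1 < C ∧
      ∀ (G : (n : ℕ) → SimpleGraph (Fin n)) [∀ n, DecidableRel (G n).Adj],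
        (∀ᶠ n : ℕ in atTop,
          ((k : ℝ) / ((k : ℝ) + 1) + ε) * (n : ℝ) ≤ ((G n).minDegree : ℝ)) →
        ∃ R : (n : ℕ) → Finset (Fin n),
          (∀ n : ℕ, (R n).card = ⌊γ ^ 2 * (n : ℝ)⌋₊) ∧
          ∀ p : ℕ → unitInterval,
            (∀ᶠ n : ℕ in atTop, C / (n : ℝ) ≤ (p n : ℝ)) →
            Tendsto
              (fun n : ℕ => SimpleGraph.binomialRandom (Fin n) (p n)
                {Γ : SimpleGraph (Fin n) | IsReservoir k ε (G n) (G n ⊔ Γ) (R n)})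
              atTop (𝓝 1) := by
  have hγ : γ ^ 2 < 1 := pow_lt_one₀ hγ₀.le hγ₁ two_ne_zero
  have hk : (k : ℝ) / (k + 1) = 1 - 1 / (k + 1 : ℕ) := by
    push_cast
    field_simp
    ring
  obtain ⟨C, M, n₀, m, bound⟩ :=
    exists_binomialRandom_real_not_isReservoir_le k (by positivity : 0 < ε * γ ^ 2 / 4)
  refine ⟨max C 2, one_lt_two.trans_le (le_max_right _ _), fun G _ hG => ?_⟩
  obtain ⟨R, hR, dense⟩ := exists_forall_and_eventually
    (fun n => exists_finset_fin_card_eq_floor_mul n hγ.le) <| hG.mp <|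
    (eventually_exists_forall_hasDenseCommonNeighbors k.succ_pos hε (pow_pos hγ₀ 2) hγ).mono
      fun n hn hGn => hn (G n) (hk ▸ hGn)
  refine ⟨R, hR, fun p hp =>
    tendsto_measure_one_of_tendsto_measureReal_compl_zero (fun _ => .of_discrete) ?_⟩
  have bound_tendsto := (tendsto_pow_mul_exp_neg_mul m one_pos).const_mul M
  simp only [mul_zero, one_mul] at bound_tendsto
  refine squeeze_zero' (.of_forall fun _ => measureReal_nonneg) ?_ bound_tendsto
  filter_upwards [dense, hp, eventually_ge_atTop n₀, eventually_gt_atTop 0] with n hRn hpn hn hn₀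
  have : Nonempty (Fin n) := ⟨⟨0, hn₀⟩⟩
  have hC : C ≤ p n * n := (le_max_left _ _).trans ((div_le_iff₀ (Nat.cast_pos.2 hn₀)).1 hpn)
  exact (bound (Fin n) (by simpa using hn) (G n) (R n) ε hRn (p n) (by simpa using hC)).trans_eq
    (by rw [Fintype.card_fin])
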